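/- Let $N\ge 2$ be an integer. For $p\in(1,\infty)$ the normalized $p$-Laplacian on $\mathbb{R}^N$ is defined, where $Du\neq 0$, by \[ -\widetilde\Delta_p u=-\frac1p|Du|^{2-p}\,\mathrm{div}(|Du|^{p-2}Du)=-\mathrm{Tr}\big(A(Du)D^2u\big),\qquad A(\xi)=\frac1p\Big(I_N+(p-2)\frac{\xi\otimes \xi}{|\xi|^2}\Big)\quad(\xi\ne0). \] A function $u:\mathbb{R}^N\to[0,\infty)$ is a nonnegative viscosity solution of $-\widetilde\Delta_p u\ge u^q+|Du|^\gamma$ in $\mathbb{R}^N$ if it is lower semicontinuous and, whenever $\varphi$ is $C^2$ in a neighbourhood of a point $x_0$ and $u-\varphi$ has a local minimum at $x_0$, one has \[ -\mathrm{Tr}\big(A(D\varphi(x_0))D^2\varphi(x_0)\big)\ge u(x_0)^q+|D\varphi(x_0)|^\gamma\quad\text{if } D\varphi(x_0)\ne0, \] \[ \max_{|e|=1}-\mathrm{Tr}\big(A(e)D^2\varphi(x_0)\big)\ge u(x_0)^q\quad\text{if } D\varphi(x_0)=0 \] (that is, at points where the gradient vanishes the operator is replaced by its upper semicontinuous envelope).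 Then every nonnegative viscosity solution of \[ -\widetilde\Delta_p u\ge u^q+|Du|^\gamma\quad\text{in }\mathbb{R}^N \] is constant in each of the following two cases: (i) $p>2$, $\;1<\gamma\le\dfrac{(p-1)(N-1)+1}{(p-1)(N-1)}$ and $q>\dfrac{(p-1)(N-1)+1}{(p-1)(N-1)-1}$; (ii) $1<p<2$, $\;1<\gamma\le\dfrac{N+p-2}{N-1}$ and $q>\dfrac{N+p-2}{N-p}$. -/

import Mathlib

noncomputable section

/-- The Hessian matrix `D²φ(x)`, with entries `∂ᵢ∂ⱼφ(x)`. -/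
def hessianMatrix {N : ℕ} (φ : EuclideanSpace ℝ (Fin N) → ℝ) (x : EuclideanSpace ℝ (Fin N)) :
    Matrix (Fin N) (Fin N) ℝ :=
  Matrix.of fun i j =>
    fderiv ℝ (fun y => fderiv ℝ φ y (EuclideanSpace.single j (1 : ℝ))) x
      (EuclideanSpace.single i (1 : ℝ))

/-- The coefficient matrix `A(ξ) = (1/p) (I + (p - 2) ξ ⊗ ξ / |ξ|²)`, meaningful for `ξ ≠ 0`. -/
def normalizedPMatrix {N : ℕ} (p : ℝ) (ξ : EuclideanSpace ℝ (Fin N)) :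
    Matrix (Fin N) (Fin N) ℝ :=
  (1 / p) • (1 + ((p - 2) / ‖ξ‖ ^ 2) • Matrix.vecMulVec (fun i => ξ i) (fun j => ξ j))

/-- The operator `-Tr(A(ξ) X)`, for `ξ ≠ 0`: the negative normalized `p`-Laplacian of a function
with gradient `ξ` and Hessian `X`. -/
def negNormalizedPLaplacian {N : ℕ} (p : ℝ) (ξ : EuclideanSpace ℝ (Fin N))
    (X : Matrix (Fin N) (Fin N) ℝ) : ℝ :=
  -(normalizedPMatrix p ξ * X).trace

/-- The upper semicontinuous envelope of `(ξ, X) ↦ -Tr(A(ξ) X)` (`ξ ≠ 0`). As `A(ξ)` depends only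
on the direction of `ξ`, and continuously so, the envelope is the operator itself where `ξ ≠ 0`,
and at `ξ = 0` it is the maximum of `-Tr(A(e) X)` over the unit vectors `e`. -/
def negNormalizedPLaplacianUpper {N : ℕ} (p : ℝ) (ξ : EuclideanSpace ℝ (Fin N))
    (X : Matrix (Fin N) (Fin N) ℝ) : ℝ :=
  open Classical in
  if ξ = 0 then
    ⨆ e : Metric.sphere (0 : EuclideanSpace ℝ (Fin N)) 1, negNormalizedPLaplacian p (e : _) X
  else negNormalizedPLaplacian p ξ X

/-- `u` is a viscosity solution of the inequality `-Δ̃ₚ u ≥ u ^ q + |Du| ^ γ` in `ℝᴺ`: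
it is lower semicontinuous, and each `φ` that is `C²` near a point `x` and touches `u` from below
there (up to an additive constant) satisfies the inequality at `x`, the operator being replaced by
its upper semicontinuous envelope. -/
def IsViscositySolutionGe {N : ℕ} (p q γ : ℝ) (u : EuclideanSpace ℝ (Fin N) → ℝ) : Prop :=
  LowerSemicontinuous u ∧
    ∀ (φ : EuclideanSpace ℝ (Fin N) → ℝ) (x : EuclideanSpace ℝ (Fin N)),
      ContDiffAt ℝ 2 φ x → IsLocalMin (fun y => u y - φ y) x →
        u x ^ q + ‖gradient φ x‖ ^ γ ≤
          negNormalizedPLaplacianUpper p (gradient φ x) (hessianMatrix φ x)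

end

open Filter Topology

/-! A nonnegative supersolution satisfies `-Δ̃ₚ u ≥ |Du|^γ`, because `u^q ≥ 0`, and this alone
forces constancy once `(γ-1)(N-1) ≤ p-1`, which both cases imply.

The core is that a lower bound `m ≥ 0` for `u` on one ball holds everywhere. Fix a point outside the
ball and compare `u` on an annulus with `m + g`, where `g` is a decreasing radial strict subsolution
vanishing on the inner sphere, at most `-m` on the outer one, and at least `-δ` at the given point
(`exists_barrier`); then let `δ → 0`. If `u y < c < u x`, lower semicontinuity gives `u > c` on a
ball around `x`, hence `u y ≥ c`, a contradiction.

With `h = -g'` the barrier condition is the first-order inequality `(p-1)h' + (N-1)h/s < p h^γ`. For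
`p ≥ N` a small multiple of `-log` serves; for `p < N` one needs a profile that blows up at a finite
but arbitrarily remote radius. -/

/-- The radial profile `g` is a `C²` strictly decreasing strict subsolution at radius `s`. -/
def IsStrictRadialSubsolutionAt (N : ℕ) (p γ : ℝ) (g : ℝ → ℝ) (s : ℝ) : Prop :=
  ContDiffAt ℝ 2 g s ∧ deriv g s < 0 ∧
    -((p - 1) * deriv (deriv g) s + ((N : ℝ) - 1) * deriv g s / s) < p * (-deriv g s) ^ γ

/-! ### The operator on radial functions. -/

section Radial

variable {N : ℕ} {g : ℝ → ℝ} {x₀ z : EuclideanSpace ℝ (Fin N)}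

theorem hasFDerivAt_norm_sub_const (hz : z ≠ x₀) :
    HasFDerivAt (fun y => ‖y - x₀‖) ((1 / ‖z - x₀‖) • innerSL ℝ (z - x₀)) z := by
  have h0 : ‖z - x₀‖ ≠ 0 := norm_ne_zero_iff.2 (sub_ne_zero.2 hz)
  have h1 : HasFDerivAt (fun y : EuclideanSpace ℝ (Fin N) => ‖y - x₀‖ ^ 2)
      (2 • (innerSL ℝ (z - x₀)).comp (ContinuousLinearMap.id ℝ _)) z :=
    ((hasFDerivAt_id z).sub_const x₀).norm_sq
  have h2 := h1.sqrt (pow_ne_zero 2 h0)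
  simp only [Real.sqrt_sq (norm_nonneg _)] at h2
  refine h2.congr_fderiv ?_
  ext v
  simp
  field_simp

theorem hasFDerivAt_radial (hz : z ≠ x₀) (hg : DifferentiableAt ℝ g ‖z - x₀‖) :
    HasFDerivAt (fun y => g ‖y - x₀‖)
      ((deriv g ‖z - x₀‖ / ‖z - x₀‖) • innerSL ℝ (z - x₀)) z := by
  refine (hg.hasDerivAt.comp_hasFDerivAt z (hasFDerivAt_norm_sub_const hz)).congr_fderiv ?_
  rw [smul_smul, mul_one_div]

theorem gradient_radial (hz : z ≠ x₀) (hg : DifferentiableAt ℝ g ‖z - x₀‖) :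
    gradient (fun y => g ‖y - x₀‖) z = (deriv g ‖z - x₀‖ / ‖z - x₀‖) • (z - x₀) := by
  refine HasGradientAt.gradient ?_
  rw [hasGradientAt_iff_hasFDerivAt]
  refine (hasFDerivAt_radial hz hg).congr_fderiv ?_
  ext v
  simp

theorem contDiffAt_radial (hz : z ≠ x₀) (hg : ContDiffAt ℝ 2 g ‖z - x₀‖) :
    ContDiffAt ℝ 2 (fun y => g ‖y - x₀‖) z :=
  hg.comp z ((contDiffAt_id.sub contDiffAt_const).norm ℝ (sub_ne_zero.2 hz))

theorem hessianMatrix_radial (hz : z ≠ x₀) (hg : ContDiffAt ℝ 2 g ‖z - x₀‖) :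
    hessianMatrix (fun y => g ‖y - x₀‖) z =
      (deriv g ‖z - x₀‖ / ‖z - x₀‖) • (1 : Matrix (Fin N) (Fin N) ℝ) +
      ((deriv (deriv g) ‖z - x₀‖ - deriv g ‖z - x₀‖ / ‖z - x₀‖) / ‖z - x₀‖ ^ 2) •
        Matrix.vecMulVec (fun i => (z - x₀) i) (fun j => (z - x₀) j) := by
  have h0 : ‖z - x₀‖ ≠ 0 := norm_ne_zero_iff.2 (sub_ne_zero.2 hz)
  have hev : ∀ᶠ y in 𝓝 z, DifferentiableAt ℝ g ‖y - x₀‖ := by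
    have h1 : ∀ᶠ s in 𝓝 ‖z - x₀‖, ContDiffAt ℝ 2 g s := hg.eventually (by simp)
    have h2 : Tendsto (fun y => ‖y - x₀‖) (𝓝 z) (𝓝 ‖z - x₀‖) :=
      Continuous.tendsto (by fun_prop) z
    exact (h2.eventually h1).mono fun y hy => hy.differentiableAt (by simp)
  have hg' : HasDerivAt (deriv g) (deriv (deriv g) ‖z - x₀‖) ‖z - x₀‖ := by
    refine DifferentiableAt.hasDerivAt ?_
    have : ContDiffAt ℝ 1 (deriv g) ‖z - x₀‖ :=
      (hg.fderiv_right (m := 1) (by norm_num)).clm_apply contDiffAt_const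
    exact this.differentiableAt (by simp)
  have hq : HasDerivAt (fun s => deriv g s / s)
      ((deriv (deriv g) ‖z - x₀‖ - deriv g ‖z - x₀‖ / ‖z - x₀‖) / ‖z - x₀‖) ‖z - x₀‖ := by
    refine (hg'.div (hasDerivAt_id' _) h0).congr_deriv ?_
    field_simp
  ext i j
  have hj : HasFDerivAt (fun y : EuclideanSpace ℝ (Fin N) => (y - x₀) j)
      (EuclideanSpace.proj j : EuclideanSpace ℝ (Fin N) →L[ℝ] ℝ) z := by
    simpa using ((EuclideanSpace.proj j : EuclideanSpace ℝ (Fin N) →L[ℝ] ℝ).hasFDerivAt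
      (x := z)).sub_const (x₀ j)
  have hprod := (hq.comp_hasFDerivAt z (hasFDerivAt_norm_sub_const hz)).mul hj
  have heq : (fun y => fderiv ℝ (fun y => g ‖y - x₀‖) y (EuclideanSpace.single j (1 : ℝ)))
      =ᶠ[𝓝 z] fun y => (deriv g ‖y - x₀‖ / ‖y - x₀‖) * (y - x₀) j := by
    filter_upwards [hev, isOpen_ne.mem_nhds hz] with y hy hyx
    rw [(hasFDerivAt_radial hyx hy).fderiv]
    simp [EuclideanSpace.inner_single_right]
  simp only [hessianMatrix, Matrix.of_apply]
  rw [heq.fderiv_eq]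
  refine (congrArg (fun L => L (EuclideanSpace.single i (1 : ℝ)))
    (HasFDerivAt.fderiv hprod)).trans ?_
  simp [EuclideanSpace.inner_single_right, Matrix.vecMulVec_apply, Matrix.one_apply,
    eq_comm (a := j)]
  field_simp

/-- Radial and tangential directions diagonalise both matrices: `A` has eigenvalues `(p-1)/p` and
`1/p`, the Hessian `g''` and `g'/r`, with multiplicities `1` and `N-1`. -/
theorem negNormalizedPLaplacian_radial {p : ℝ} (hz : z ≠ x₀)
    (hg : ContDiffAt ℝ 2 g ‖z - x₀‖) (hd : deriv g ‖z - x₀‖ ≠ 0) :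
    negNormalizedPLaplacian p (gradient (fun y => g ‖y - x₀‖) z)
        (hessianMatrix (fun y => g ‖y - x₀‖) z) =
      -(1 / p * ((p - 1) * deriv (deriv g) ‖z - x₀‖ +
        ((N : ℝ) - 1) * deriv g ‖z - x₀‖ / ‖z - x₀‖)) := by
  have h0 : ‖z - x₀‖ ≠ 0 := norm_ne_zero_iff.2 (sub_ne_zero.2 hz)
  have hs : (fun i => (z - x₀) i) ⬝ᵥ (fun i => (z - x₀) i) = ‖z - x₀‖ ^ 2 := by
    rw [EuclideanSpace.norm_sq_eq]
    simp [dotProduct, sq]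
  rw [hessianMatrix_radial hz hg, gradient_radial hz (hg.differentiableAt (by simp)),
    negNormalizedPLaplacian, normalizedPMatrix]
  set r := ‖z - x₀‖
  set d := deriv g r
  have hv : (Matrix.vecMulVec (fun i => ((d / r) • (z - x₀)) i) fun j => ((d / r) • (z - x₀)) j)
      = (d / r) ^ 2 • Matrix.vecMulVec (fun i => (z - x₀) i) (fun j => (z - x₀) j) := by
    ext i j
    simp [Matrix.vecMulVec_apply]
    ring
  have hn : ‖(d / r) • (z - x₀)‖ ^ 2 = d ^ 2 := by
    rw [norm_smul, mul_pow, Real.norm_eq_abs, sq_abs]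
    change (d / r) ^ 2 * r ^ 2 = _
    field_simp
  rw [hv, hn]
  simp only [add_mul, mul_add, Matrix.smul_mul, Matrix.mul_smul, Matrix.one_mul, Matrix.mul_one,
    Matrix.trace_add, Matrix.trace_smul, Matrix.trace_one, Matrix.vecMulVec_mul_vecMulVec,
    Matrix.trace_vecMulVec, hs, smul_eq_mul, Fintype.card_fin, dotProduct_smul]
  field_simp
  ring

end Radial

/-! ### Comparison on annuli. -/

/-- Comparison of a viscosity supersolution with a strict radial subsolution on an annulus. -/
theorem IsViscositySolutionGe.radial_le {N : ℕ} {p q γ : ℝ} (hp : 0 < p)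
    {u : EuclideanSpace ℝ (Fin N) → ℝ} (hu₀ : ∀ x, 0 ≤ u x) (hu : IsViscositySolutionGe p q γ u)
    {x₀ : EuclideanSpace ℝ (Fin N)} {R₁ R₂ : ℝ} (hR₁ : 0 < R₁) {g : ℝ → ℝ}
    (hg : ∀ s ∈ Set.Icc R₁ R₂, IsStrictRadialSubsolutionAt N p γ g s)
    (h₁ : ∀ y, ‖y - x₀‖ = R₁ → g R₁ ≤ u y) (h₂ : ∀ y, ‖y - x₀‖ = R₂ → g R₂ ≤ u y)
    {x : EuclideanSpace ℝ (Fin N)} (hx : ‖x - x₀‖ ∈ Set.Icc R₁ R₂) : g ‖x - x₀‖ ≤ u x := by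
  set K : Set (EuclideanSpace ℝ (Fin N)) := {y | ‖y - x₀‖ ∈ Set.Icc R₁ R₂} with hK
  have hcont : Continuous fun y : EuclideanSpace ℝ (Fin N) => ‖y - x₀‖ := by fun_prop
  have hKc : IsCompact K := by
    refine (isCompact_closedBall x₀ R₂).of_isClosed_subset (isClosed_Icc.preimage hcont) ?_
    intro y hy
    rw [mem_closedBall_iff_norm]
    exact hy.2
  have hgc : ContinuousOn (fun y => - g ‖y - x₀‖) K := by
    intro y hy
    exact ((hg _ hy).1.continuousAt.comp (f := fun y => ‖y - x₀‖) hcont.continuousAt).neg.continuousWithinAt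
  have hlsc : LowerSemicontinuousOn (fun y => u y + - g ‖y - x₀‖) K :=
    (hu.1.lowerSemicontinuousOn K).add hgc.lowerSemicontinuousOn
  obtain ⟨z, hzK, hz⟩ := hlsc.exists_isMinOn ⟨x, hx⟩ hKc
  by_contra! hlt
  have hzlt : u z < g ‖z - x₀‖ := by
    have := hz hx
    simp only [Set.mem_ofPred_eq] at this
    linarith
  have hz₁ : R₁ < ‖z - x₀‖ := by
    refine lt_of_le_of_ne hzK.1 fun h => ?_
    have := h₁ z h.symm
    rw [← h] at hzlt
    linarith
  have hz₂ : ‖z - x₀‖ < R₂ := by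
    refine lt_of_le_of_ne hzK.2 fun h => ?_
    have := h₂ z h
    rw [h] at hzlt
    linarith
  have hloc : IsLocalMin (fun y => u y - g ‖y - x₀‖) z := by
    have hmem : K ∈ 𝓝 z := hcont.continuousAt.preimage_mem_nhds (Icc_mem_nhds hz₁ hz₂)
    simpa only [sub_eq_add_neg] using hz.isLocalMin hmem
  have hzx : z ≠ x₀ := by
    rintro rfl
    simp at hz₁
    linarith
  obtain ⟨hC, hd, hstrict⟩ := hg _ hzK
  have hr : 0 < ‖z - x₀‖ := hR₁.trans hz₁
  have hgrad := gradient_radial hzx (hC.differentiableAt (by simp))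
  have hnorm : ‖gradient (fun y => g ‖y - x₀‖) z‖ = -deriv g ‖z - x₀‖ := by
    rw [hgrad, norm_smul, norm_div, norm_norm, Real.norm_eq_abs, abs_of_neg hd]
    field_simp
  -- A nonzero gradient at the touching point means the envelope is the operator itself.
  have hne : gradient (fun y => g ‖y - x₀‖) z ≠ 0 := by
    rw [← norm_ne_zero_iff, hnorm]
    linarith
  have key := hu.2 _ z (contDiffAt_radial hzx hC) hloc
  rw [negNormalizedPLaplacianUpper, if_neg hne, negNormalizedPLaplacian_radial hzx hC hd.ne,
    hnorm] at key
  have hq := Real.rpow_nonneg (hu₀ z) q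
  have h3 : p * (-deriv g ‖z - x₀‖) ^ γ ≤ p * -(1 / p * ((p - 1) * deriv (deriv g) ‖z - x₀‖ +
        ((N : ℝ) - 1) * deriv g ‖z - x₀‖ / ‖z - x₀‖)) :=
    mul_le_mul_of_nonneg_left (by linarith) hp.le
  have h4 : p * -(1 / p * ((p - 1) * deriv (deriv g) ‖z - x₀‖ +
        ((N : ℝ) - 1) * deriv g ‖z - x₀‖ / ‖z - x₀‖)) = -((p - 1) * deriv (deriv g) ‖z - x₀‖ +
        ((N : ℝ) - 1) * deriv g ‖z - x₀‖ / ‖z - x₀‖) := by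
    field_simp
  linarith

/-! ### Construction of barriers. -/

theorem isStrictRadialSubsolutionAt_of_hasDerivAt {N : ℕ} {p γ : ℝ} {g h : ℝ → ℝ} {U : Set ℝ}
    (hU : IsOpen U) (hg : ∀ s ∈ U, HasDerivAt g (-h s) s) (hh : ContDiffOn ℝ 1 h U) {s d : ℝ}
    (hs : s ∈ U) (hd : HasDerivAt h d s) (hpos : 0 < h s)
    (hlt : (p - 1) * d + ((N : ℝ) - 1) * h s / s < p * h s ^ γ) :
    IsStrictRadialSubsolutionAt N p γ g s := by
  have hev : deriv g =ᶠ[𝓝 s] fun t => -h t := by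
    filter_upwards [hU.mem_nhds hs] with t ht using (hg t ht).deriv
  have h2 : deriv (deriv g) s = -d := by rw [hev.deriv_eq]; exact hd.neg.deriv
  refine ⟨?_, ?_, ?_⟩
  · have : ContDiffOn ℝ (1 + 1) g U := by
      rw [contDiffOn_succ_iff_deriv_of_isOpen hU]
      refine ⟨fun t ht => (hg t ht).differentiableAt.differentiableWithinAt, by simp, ?_⟩
      exact hh.neg.congr fun t ht => (hg t ht).deriv
    have h3 := this.contDiffAt (hU.mem_nhds hs)
    rwa [one_add_one_eq_two] at h3
  · rw [(hg s hs).deriv]; linarith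
  · rw [h2, (hg s hs).deriv, neg_neg]
    refine lt_of_eq_of_lt ?_ hlt
    ring

theorem exists_log_barrier {N : ℕ} {p γ : ℝ} (hp : 1 < p) (hNp : (N : ℝ) ≤ p)
    {R r M δ : ℝ} (hR : 0 < R) (hr : R < r) (hδ : 0 < δ) :
    ∃ (R₂ : ℝ) (g : ℝ → ℝ), r < R₂ ∧ g R = 0 ∧ g R₂ ≤ -M ∧ -δ ≤ g r ∧
      ∀ s ∈ Set.Icc R R₂, IsStrictRadialSubsolutionAt N p γ g s := by
  have hlog : 0 < Real.log r - Real.log R := sub_pos.2 (Real.log_lt_log hR hr)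
  set ε := δ / (Real.log r - Real.log R) with hε
  have hε0 : 0 < ε := div_pos hδ hlog
  -- The second entry is the radius where the profile equals `-M`.
  refine ⟨max (r + 1) (R * Real.exp (M / ε)), fun s => -ε * (Real.log s - Real.log R),
    lt_max_of_lt_left (by linarith), by simp, ?_, ?_, ?_⟩
  · have h1 : Real.log (R * Real.exp (M / ε)) ≤ Real.log (max (r + 1) (R * Real.exp (M / ε))) :=
      Real.log_le_log (by positivity) (le_max_right _ _)
    rw [Real.log_mul hR.ne' (Real.exp_ne_zero _), Real.log_exp] at h1
    have h2 : ε * (M / ε) = M := by field_simp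
    have h3 : ε * (M / ε) ≤
        ε * (Real.log (max (r + 1) (R * Real.exp (M / ε))) - Real.log R) :=
      mul_le_mul_of_nonneg_left (by linarith) hε0.le
    simp only
    linarith
  · have : ε * (Real.log r - Real.log R) = δ := by rw [hε]; field_simp
    simp only
    linarith
  · intro s hs
    have hs0 : 0 < s := hR.trans_le hs.1
    refine isStrictRadialSubsolutionAt_of_hasDerivAt (h := fun s => ε * s⁻¹) (d := ε * -(s ^ 2)⁻¹)
      isOpen_Ioi (fun t ht => ?_) ?_ (Set.mem_Ioi.2 hs0) ((hasDerivAt_inv hs0.ne').const_mul ε)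
      (by positivity) ?_
    · exact (((Real.hasDerivAt_log (ne_of_gt ht)).sub_const _).const_mul (-ε)).congr_deriv (by ring)
    · exact contDiffOn_const.mul (contDiffOn_id.inv fun t ht => ne_of_gt ht)
    · have h1 : (p - 1) * (ε * -(s ^ 2)⁻¹) + ((N : ℝ) - 1) * (ε * s⁻¹) / s
          = -((p - N) * (ε * (s ^ 2)⁻¹)) := by field_simp; ring
      have h2 : 0 ≤ (p - N) * (ε * (s ^ 2)⁻¹) := mul_nonneg (by linarith) (by positivity)
      have h3 : 0 < p * (ε * s⁻¹) ^ γ := by positivity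
      linarith

/-- Take `h = v^(-b)` with `b = 1/(γ-1)` and `v = κ s log(S/s)`. Since `bγ = b+1`, dividing by
`v^(-b-1)` turns the inequality into `(N-1)v/s - (p-1)b(v/s - κ) < p`, where `N-1 ≤ (p-1)b` cancels
the `v/s` terms. As `S → ∞`, `h` becomes small on `[R, r]`; as `γ ≤ 2` gives `b ≥ 1`, `h` is not
integrable at `S`. -/
theorem exists_blowup_barrier {N : ℕ} {p γ : ℝ} (hp : 1 < p) (hγ : 1 < γ) (hγ2 : γ ≤ 2)
    (hcrit : (γ - 1) * ((N : ℝ) - 1) ≤ p - 1)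
    {R r M δ : ℝ} (hR : 0 < R) (hr : R < r) (hM : 0 ≤ M) (hδ : 0 < δ) :
    ∃ (R₂ : ℝ) (g : ℝ → ℝ), r < R₂ ∧ g R = 0 ∧ g R₂ ≤ -M ∧ -δ ≤ g r ∧
      ∀ s ∈ Set.Icc R R₂, IsStrictRadialSubsolutionAt N p γ g s := by
  set b := 1 / (γ - 1) with hb
  have hγ1 : 0 < γ - 1 := by linarith
  have hb1 : 1 ≤ b := by rw [hb, le_div_iff₀ hγ1]; linarith
  have hb0 : 0 < b := by linarith
  have hbγ : b * γ = b + 1 := by rw [hb]; field_simp; ring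
  have hcrit' : (N : ℝ) - 1 ≤ (p - 1) * b := by
    rw [hb, mul_one_div, le_div_iff₀ hγ1]; linarith
  have hp1 : 0 < p - 1 := by linarith
  -- Half the value at which the inequality would be an equality in the critical case.
  set κ := p / (2 * ((p - 1) * b)) with hκ
  have hκ0 : 0 < κ := by positivity
  have hκ' : (p - 1) * b * κ < p := by
    have : (p - 1) * b * κ = p / 2 := by rw [hκ]; field_simp
    linarith
  -- the blow-up radius, large enough for the profile to stay above `-δ` up to radius `r`
  obtain ⟨S, hSr, hS⟩ : ∃ S, r < S ∧ (κ * R * (Real.log S - Real.log r)) ^ (-b) * (r - R) ≤ δ := by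
    have h1 : Tendsto (fun S => κ * R * (Real.log S - Real.log r)) atTop atTop :=
      (tendsto_atTop_add_const_right _ _ Real.tendsto_log_atTop).const_mul_atTop (by positivity)
    have h2 := ((tendsto_rpow_neg_atTop hb0).comp h1).mul_const (r - R)
    rw [zero_mul] at h2
    obtain ⟨S, hS1, hS2⟩ := ((h2.eventually (ge_mem_nhds hδ)).and (eventually_gt_atTop r)).exists
    exact ⟨S, hS2, hS1⟩
  have hr0 : 0 < r := hR.trans hr
  set v : ℝ → ℝ := fun s => κ * (s * (Real.log S - Real.log s)) with hv
  set h : ℝ → ℝ := fun s => v s ^ (-b) with hh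
  set U := Set.Ioo 0 S with hUdef
  have hU : IsOpen U := isOpen_Ioo
  have hvpos : ∀ s ∈ U, 0 < v s := fun s hs =>
    mul_pos hκ0 (mul_pos hs.1 (sub_pos.2 (Real.log_lt_log hs.1 hs.2)))
  have hhpos : ∀ s ∈ U, 0 < h s := fun s hs => Real.rpow_pos_of_pos (hvpos s hs) _
  have hvder : ∀ s ∈ U, HasDerivAt v (v s / s - κ) s := by
    intro s hs
    have hs0 : s ≠ 0 := hs.1.ne'
    refine (((hasDerivAt_id' s).mul
      ((Real.hasDerivAt_log hs0).const_sub (Real.log S))).const_mul κ).congr_deriv ?_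
    simp only [hv]
    field_simp
    ring
  have hhder : ∀ s ∈ U, HasDerivAt h ((v s / s - κ) * (-b) * v s ^ (-b - 1)) s := fun s hs =>
    (hvder s hs).rpow_const (Or.inl (hvpos s hs).ne')
  have hvC : ContDiffOn ℝ 1 v U :=
    contDiffOn_const.mul (contDiffOn_id.mul (contDiffOn_const.sub
      (contDiffOn_id.log fun s hs => ne_of_gt hs.1)))
  have hhC : ContDiffOn ℝ 1 h U := hvC.rpow_const_of_ne fun s hs => (hvpos s hs).ne'
  have hRU : R ∈ U := ⟨hR, hr.trans hSr⟩
  have hrU : r ∈ U := ⟨hr0, hSr⟩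
  set g : ℝ → ℝ := fun s => -∫ t in R..s, h t with hg
  have hgder : ∀ s ∈ U, HasDerivAt g (-h s) s := by
    intro s hs
    have hsub : Set.uIcc R s ⊆ U := Set.ordConnected_Ioo.uIcc_subset hRU hs
    exact (intervalIntegral.integral_hasDerivAt_right
      ((hhC.continuousOn.mono hsub).intervalIntegrable)
      (hhC.continuousOn.stronglyMeasurableAtFilter hU s hs)
      (hhC.continuousOn.continuousAt (hU.mem_nhds hs))).neg
  have hsubR : ∀ s₁ ∈ U, ∀ s₂ ∈ U, Set.Icc s₁ s₂ ⊆ U := fun s₁ h₁ s₂ h₂ t ht =>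
    ⟨h₁.1.trans_le ht.1, ht.2.trans_lt h₂.2⟩
  have hgR : g R = 0 := by simp [hg]
  have hanti : ∀ s ∈ U, R ≤ s → g s ≤ 0 := by
    intro s hs hRs
    rw [← hgR]
    refine antitoneOn_of_deriv_nonpos (convex_Ioo 0 S)
      (fun t ht => (hgder t ht).continuousAt.continuousWithinAt) (fun t ht => ?_) (fun t ht => ?_)
      hRU hs hRs
    · exact (hgder t (interior_subset ht)).differentiableAt.differentiableWithinAt
    · rw [(hgder t (interior_subset ht)).deriv]
      linarith [hhpos t (interior_subset ht)]
  have hgr : -δ ≤ g r := by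
    have hb' : ∀ t ∈ Set.Ioo R r, -((κ * R * (Real.log S - Real.log r)) ^ (-b)) ≤ deriv g t := by
      intro t ht
      have htU : t ∈ U := hsubR R hRU r hrU (Set.Ioo_subset_Icc_self ht)
      rw [(hgder t htU).deriv, neg_le_neg_iff]
      have hl : 0 < Real.log S - Real.log r := sub_pos.2 (Real.log_lt_log hr0 hSr)
      refine Real.rpow_le_rpow_of_nonpos (by positivity) ?_ (by linarith)
      have hlt : Real.log t ≤ Real.log r := Real.log_le_log htU.1 ht.2.le
      simp only [hv]
      rw [mul_assoc]
      refine mul_le_mul_of_nonneg_left ?_ hκ0.le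
      exact mul_le_mul ht.1.le (by linarith) hl.le htU.1.le
    have := (convex_Icc R r).mul_sub_le_image_sub_of_le_deriv (f := g)
      (fun t ht => (hgder t (hsubR R hRU r hrU ht)).continuousAt.continuousWithinAt)
      (fun t ht => (hgder t (hsubR R hRU r hrU
        (interior_subset ht))).differentiableAt.differentiableWithinAt)
      (by rw [interior_Icc]; exact hb') R (Set.left_mem_Icc.2 hr.le) r (Set.right_mem_Icc.2 hr.le)
      hr.le
    rw [hgR] at this
    linarith
  -- the profile tends to `-∞` at the blow-up radius
  obtain ⟨s₁, hs₁r, hs₁S, hs₁⟩ : ∃ s₁, r < s₁ ∧ s₁ < S ∧ κ * (S - s₁) ≤ 1 := by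
    refine ⟨max ((r + S) / 2) (S - 1 / κ), lt_max_of_lt_left (by linarith),
      max_lt (by linarith) (by have : 0 < 1 / κ := by positivity
                               linarith), ?_⟩
    have h1 : S - max ((r + S) / 2) (S - 1 / κ) ≤ 1 / κ := by
      linarith [le_max_right ((r + S) / 2) (S - 1 / κ)]
    have h2 := mul_le_mul_of_nonneg_left h1 hκ0.le
    rwa [mul_one_div_cancel hκ0.ne'] at h2
  have hs₁U : s₁ ∈ U := ⟨hr0.trans hs₁r, hs₁S⟩
  -- Chosen so that `∫ 1/(κ(S-t))` over `[s₁, R₂]` is exactly `M`.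
  set R₂ := S - (S - s₁) * Real.exp (-(κ * M)) with hR₂
  have hS₁ : 0 < S - s₁ := by linarith
  have hR₂S : R₂ < S := by
    have : 0 < (S - s₁) * Real.exp (-(κ * M)) := by positivity
    linarith
  have hs₁R₂ : s₁ ≤ R₂ := by
    have h1 : Real.exp (-(κ * M)) ≤ 1 := Real.exp_le_one_iff.2 (by
      have : 0 ≤ κ * M := by positivity
      linarith)
    have := mul_le_mul_of_nonneg_left h1 hS₁.le
    linarith
  have hR₂U : R₂ ∈ U := ⟨hs₁U.1.trans_le hs₁R₂, hR₂S⟩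
  have hhlow : ∀ t ∈ Set.Icc s₁ R₂, 1 / (κ * (S - t)) ≤ h t := by
    intro t ht
    have htU : t ∈ U := hsubR s₁ hs₁U R₂ hR₂U ht
    have hSt : 0 < S - t := by linarith [htU.2]
    have hvle : v t ≤ κ * (S - t) := by
      refine mul_le_mul_of_nonneg_left ?_ hκ0.le
      rw [← Real.log_div (htU.1.trans htU.2).ne' htU.1.ne']
      have h1 := Real.log_le_sub_one_of_pos (div_pos (htU.1.trans htU.2) htU.1)
      have h2 := mul_le_mul_of_nonneg_left h1 htU.1.le
      have h3 : t * (S / t - 1) = S - t := by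
        have := htU.1.ne'
        field_simp
      linarith
    -- Thus `v ≤ 1`, so `b ≥ 1` gives `v^(-b) ≥ v^(-1)`.
    have hle1 : κ * (S - t) ≤ 1 :=
      (mul_le_mul_of_nonneg_left (by linarith [ht.1]) hκ0.le).trans hs₁
    calc 1 / (κ * (S - t)) ≤ 1 / v t := one_div_le_one_div_of_le (hvpos t htU) hvle
      _ = v t ^ (-1 : ℝ) := by rw [Real.rpow_neg_one, one_div]
      _ ≤ h t := Real.rpow_le_rpow_of_exponent_ge (hvpos t htU) (hvle.trans hle1) (by linarith)
  have hgR₂ : g R₂ ≤ -M := by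
    have hder : ∀ t ∈ Set.Icc s₁ R₂, HasDerivAt (fun t => g t - 1 / κ * Real.log (S - t))
        (-h t + 1 / (κ * (S - t))) t := by
      intro t ht
      have hSt : S - t ≠ 0 := by linarith [ht.2]
      refine ((hgder t (hsubR s₁ hs₁U R₂ hR₂U ht)).sub
        ((((hasDerivAt_id' t).const_sub S).log hSt).const_mul (1 / κ))).congr_deriv ?_
      field_simp
      ring
    have h1 : g R₂ - 1 / κ * Real.log (S - R₂) ≤ g s₁ - 1 / κ * Real.log (S - s₁) := by
      refine antitoneOn_of_deriv_nonpos (f := fun t => g t - 1 / κ * Real.log (S - t))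
        (convex_Icc s₁ R₂)
        (fun t ht => (hder t ht).continuousAt.continuousWithinAt) (fun t ht => ?_)
        (fun t ht => ?_) (Set.left_mem_Icc.2 hs₁R₂) (Set.right_mem_Icc.2 hs₁R₂) hs₁R₂
      · exact (hder t (interior_subset ht)).differentiableAt.differentiableWithinAt
      · rw [(hder t (interior_subset ht)).deriv]
        linarith [hhlow t (interior_subset ht)]
    have h2 : S - R₂ = (S - s₁) * Real.exp (-(κ * M)) := by rw [hR₂]; ring
    have h3 : 1 / κ * Real.log (S - R₂) = 1 / κ * Real.log (S - s₁) - M := by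
      rw [h2, Real.log_mul hS₁.ne' (Real.exp_ne_zero _), Real.log_exp]
      field_simp
      ring
    have h4 := hanti s₁ hs₁U (hr.trans hs₁r).le
    linarith
  refine ⟨R₂, g, hs₁r.trans_le hs₁R₂, hgR, hgR₂, hgr, fun s hs => ?_⟩
  have hsU : s ∈ U := hsubR R hRU R₂ hR₂U hs
  refine isStrictRadialSubsolutionAt_of_hasDerivAt hU hgder hhC hsU (hhder s hsU)
    (hhpos s hsU) ?_
  have hvs := hvpos s hsU
  have hs0 : 0 < s := hsU.1
  have hw : 0 < v s ^ (-b - 1) := Real.rpow_pos_of_pos hvs _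
  have e1 : h s = v s ^ (-b - 1) * v s := by
    rw [← Real.rpow_add_one hvs.ne']
    simp [hh]
  have e2 : h s ^ γ = v s ^ (-b - 1) := by
    simp only [hh]
    rw [← Real.rpow_mul hvs.le]
    congr 1
    linarith
  rw [e2, e1]
  have h5 : ((N : ℝ) - 1) * (v s / s) ≤ (p - 1) * b * (v s / s) :=
    mul_le_mul_of_nonneg_right hcrit' (by positivity)
  have h6 : ((N : ℝ) - 1) * (v s / s) - (p - 1) * b * (v s / s - κ) < p := by
    rw [mul_sub]
    linarith
  have h7 := mul_lt_mul_of_pos_left h6 hw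
  refine lt_of_eq_of_lt ?_ (h7.trans_eq (mul_comm _ _))
  ring

theorem exists_barrier {N : ℕ} {p γ : ℝ} (hp : 1 < p) (hγ : 1 < γ)
    (hcrit : (γ - 1) * ((N : ℝ) - 1) ≤ p - 1)
    {R r M δ : ℝ} (hR : 0 < R) (hr : R < r) (hM : 0 ≤ M) (hδ : 0 < δ) :
    ∃ (R₂ : ℝ) (g : ℝ → ℝ), r < R₂ ∧ g R = 0 ∧ g R₂ ≤ -M ∧ -δ ≤ g r ∧
      ∀ s ∈ Set.Icc R R₂, IsStrictRadialSubsolutionAt N p γ g s := by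
  rcases le_total (N : ℝ) p with hNp | hNp
  · exact exists_log_barrier hp hNp hR hr hδ
  · refine exists_blowup_barrier hp hγ ?_ hcrit hR hr hM hδ
    -- If `γ > 2`, then `(γ-1)(N-1) > N-1 ≥ p-1`, against `hcrit`.
    by_contra! h
    have : 1 * ((N : ℝ) - 1) < (γ - 1) * ((N : ℝ) - 1) :=
      mul_lt_mul_of_pos_right (by linarith) (by linarith)
    linarith

theorem IsStrictRadialSubsolutionAt.const_add {N : ℕ} {p γ : ℝ} {g : ℝ → ℝ} {s : ℝ}
    (h : IsStrictRadialSubsolutionAt N p γ g s) (m : ℝ) :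
    IsStrictRadialSubsolutionAt N p γ (fun t => m + g t) s := by
  have hd : deriv (fun t => m + g t) = deriv g := by
    funext t
    exact deriv_const_add m
  refine ⟨contDiffAt_const.add h.1, ?_⟩
  rw [hd]
  exact h.2

/-! ### The Liouville property. -/

/-- The infimum over a ball of a nonnegative supersolution is its infimum over the whole space. -/
theorem IsViscositySolutionGe.ge_of_ge_closedBall {N : ℕ} {p q γ : ℝ} (hp : 1 < p) (hγ : 1 < γ)
    (hcrit : (γ - 1) * ((N : ℝ) - 1) ≤ p - 1)
    {u : EuclideanSpace ℝ (Fin N) → ℝ} (hu₀ : ∀ x, 0 ≤ u x) (hu : IsViscositySolutionGe p q γ u)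
    {x₀ : EuclideanSpace ℝ (Fin N)} {R m : ℝ} (hR : 0 < R) (hm : 0 ≤ m)
    (h : ∀ y ∈ Metric.closedBall x₀ R, m ≤ u y) (x : EuclideanSpace ℝ (Fin N)) : m ≤ u x := by
  rcases le_or_gt ‖x - x₀‖ R with hx | hx
  · exact h x (mem_closedBall_iff_norm.2 hx)
  refine le_of_forall_pos_le_add fun δ hδ => ?_
  obtain ⟨R₂, g, hR₂, hg1, hg2, hgx, hg⟩ := exists_barrier hp hγ hcrit hR hx hm hδ
  have := hu.radial_le (zero_lt_one.trans hp) hu₀ hR (fun s hs => (hg s hs).const_add m)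
    (fun y hy => by
      rw [hg1, add_zero]
      exact h y (mem_closedBall_iff_norm.2 hy.le))
    -- On the outer sphere the barrier is at most `m - m = 0 ≤ u`.
    (fun y _ => by linarith [hu₀ y]) ⟨hx.le, hR₂.le⟩
  linarith

theorem IsViscositySolutionGe.eq_of_subcritical {N : ℕ} {p q γ : ℝ} (hp : 1 < p) (hγ : 1 < γ)
    (hcrit : (γ - 1) * ((N : ℝ) - 1) ≤ p - 1)
    {u : EuclideanSpace ℝ (Fin N) → ℝ} (hu₀ : ∀ x, 0 ≤ u x) (hu : IsViscositySolutionGe p q γ u)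
    (x y : EuclideanSpace ℝ (Fin N)) : u x = u y := by
  suffices H : ∀ x y, u x ≤ u y from le_antisymm (H x y) (H y x)
  intro x y
  by_contra! hlt
  obtain ⟨c, hyc, hcx⟩ := exists_between hlt
  obtain ⟨R, hR, hball⟩ := Metric.nhds_basis_closedBall.eventually_iff.1 (hu.1 x c hcx)
  have := hu.ge_of_ge_closedBall hp hγ hcrit hu₀ hR ((hu₀ y).trans hyc.le)
    (fun z hz => (hball hz).le) y
  linarith

theorem mainTheorem7 (N : ℕ) (hN : 2 ≤ N) (p q γ : ℝ)
    (h : (2 < p ∧ 1 < γ ∧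
            γ ≤ ((p - 1) * ((N : ℝ) - 1) + 1) / ((p - 1) * ((N : ℝ) - 1)) ∧
            ((p - 1) * ((N : ℝ) - 1) + 1) / ((p - 1) * ((N : ℝ) - 1) - 1) < q) ∨
         (1 < p ∧ p < 2 ∧ 1 < γ ∧
            γ ≤ ((N : ℝ) + p - 2) / ((N : ℝ) - 1) ∧
            ((N : ℝ) + p - 2) / ((N : ℝ) - p) < q))
    (u : EuclideanSpace ℝ (Fin N) → ℝ) (hu_nonneg : ∀ x, 0 ≤ u x)
    (hu : IsViscositySolutionGe p q γ u) :
    ∃ c : ℝ, ∀ x, u x = c := by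
  have hN' : (2 : ℝ) ≤ N := by exact_mod_cast hN
  have hN1 : 0 < (N : ℝ) - 1 := by linarith
  have key : 1 < p ∧ 1 < γ ∧ (γ - 1) * ((N : ℝ) - 1) ≤ p - 1 := by
    rcases h with ⟨hp, hγ, hle, -⟩ | ⟨hp, -, hγ, hle, -⟩
    · refine ⟨by linarith, hγ, ?_⟩
      have hp1 : 1 < p - 1 := by linarith
      -- The bound on `γ` reads `(p-1)(γ-1)(N-1) ≤ 1`, stronger than needed since `p-1 > 1`.
      rw [le_div_iff₀ (by positivity)] at hle
      have h1 : 0 ≤ (γ - 1) * ((N : ℝ) - 1) := mul_nonneg (by linarith) hN1.le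
      have h2 : 1 * ((γ - 1) * ((N : ℝ) - 1)) ≤ (p - 1) * ((γ - 1) * ((N : ℝ) - 1)) :=
        mul_le_mul_of_nonneg_right hp1.le h1
      linarith
    · refine ⟨hp, hγ, ?_⟩
      rw [le_div_iff₀ hN1] at hle
      linarith
  exact ⟨u 0, fun x => hu.eq_of_subcritical key.1 key.2.1 key.2.2 hu_nonneg x 0⟩
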